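/- Let $M$ be a smooth manifold with a metric $d$ inducing its topology for which all closed balls $B(x,r)=\{y\in M: d(x,y)\le r\}$ are compact. Let $X=\{X_t\}_{t\ge 0}$, on a space with filtration $(\mathcal F_t)$ and laws $P_x$, $x\in M$ (with $P_x(X_0=x)=1$), be a stochastically complete $M$-valued diffusion with generator $L$: $X$ is an adapted, time-homogeneous strong Markov process with continuous sample paths in $M$ defined for all times $t\ge0$, and for every $f\in C^2(M)$ and $x\in M$ the process $f(X_t)-\int_0^t (Lf)(X_s)\,ds$ is a local martingale under $P_x$ (the time integrals being $P_x$-a.s. absolutely convergent). Put $\mu_t^x(E)=P_x(X_t\in E)$, assumed Borel measurable in $x$ for every Borel set $E$, and $(e^{tL}f)(x)=\int_M f(y)\,\mu_t^x(dy)$ whenever the integral converges absolutely. Let $\delta>0$ and suppose that $X$ is uniformly local with parameter $\delta$: there are $t,\epsilon>0$ such that $P_x(d(x,X_s)\le\delta)\ge\epsilon$ for all $x\in M$ and all $0\le s<t$. Let $f\in C^2(M)$ and $t_0,T>0$. Suppose that for every $x\in M$ there is an $\eta(x)>0$ such that (A) $\displaystyle\int_M |f(y)|^{1+\eta(x)}\,\mu_t^x(dy)<\infty$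 for all $0\le t<T$; (B) for every $0\le t<t_0$, $\displaystyle\lim_{n\to\infty}\Big(\sup_{y\in B(x,n)}|f(y)|\Big)\,P_x\big(n-\delta\le d(X_t,x)\le n+\delta\big)^{\frac1{1+\eta(x)}}=0$, where $n$ runs over the positive integers. Then: (1) If $Lf=0$, then for all $0\le t<T$ and all $x\in M$ the integral defining $(e^{tL}f)(x)$ converges absolutely and $(e^{tL}f)(x)=f(x)$. (2) If $Lf\ge0$, then for all $0\le t<T$ and all $x\in M$ the integral defining $(e^{tL}f)(x)$ converges absolutely and $(e^{tL}f)(x)\ge f(x)$. (3) If $Lf=0$, or if $Lf\ge0$ and $f\ge0$, and if $\int_M|f(y)|^p\,\mu_T^o(dy)<\infty$ for some $1\le p<\infty$ and $o\in M$, then for all $0\le s\le t<T$ $$\int_M|f(y)|^p\,\mu_s^o(dy)\le\int_M|f(y)|^p\,\mu_t^o(dy)\le\int_M|f(y)|^p\,\mu_T^o(dy).$$ -/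

import Mathlib

open MeasureTheory ProbabilityTheory Filter Topology
open scoped NNReal ENNReal Manifold

/-- The transition probability (heat kernel measure) `μ_t^x(E) = P_x(X_t ∈ E)` of a family of
laws `P_x` and a process `X`. -/
noncomputable def heatMeasure {M Ω : Type*} [MeasurableSpace M] [MeasurableSpace Ω]
    (P : M → Measure Ω) (X : ℝ≥0 → Ω → M) (t : ℝ≥0) (x : M) : Measure M :=
  (P x).map (X t)

/-- The heat operator `(e^{tL} f)(x) = ∫ f(y) μ_t^x(dy)`; it is meaningful at those `x` where
`f` is `μ_t^x`-integrable. -/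
noncomputable def heatOperator {M Ω : Type*} [MeasurableSpace M] [MeasurableSpace Ω]
    (P : M → Measure Ω) (X : ℝ≥0 → Ω → M) (t : ℝ≥0) (f : M → ℝ) (x : M) : ℝ :=
  ∫ y, f y ∂(heatMeasure P X t x)

/-- `X`, with the laws `P_x` and the filtration `F`, is a diffusion on the manifold `M` with
infinitesimal generator `L`: a time-homogeneous strong Markov process with continuous sample
paths in `M` on the whole of `[0, ∞)` (no explosion: the process is stochastically complete) which
solves the martingale problem for `L` on `C²(M)`. -/
structure IsDiffusion {d : ℕ} {M : Type*} [TopologicalSpace M]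
    [ChartedSpace (EuclideanSpace ℝ (Fin d)) M] [MeasurableSpace M]
    {Ω : Type*} [mΩ : MeasurableSpace Ω]
    (L : C^2⟮𝓡 d, M; ℝ⟯ →ₗ[ℝ] (M → ℝ)) (F : Filtration ℝ≥0 mΩ)
    (X : ℝ≥0 → Ω → M) (P : M → Measure Ω) : Prop where
  /-- Every `P_x` is a probability measure. -/
  isProbabilityMeasure : ∀ x, IsProbabilityMeasure (P x)
  /-- Under `P_x` the process starts at `x`. -/
  start : ∀ x, ∀ᵐ ω ∂(P x), X 0 ω = x
  /-- The process is adapted. -/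
  adapted : ∀ t, Measurable[F t] (X t)
  /-- The sample paths are continuous. -/
  continuous_path : ∀ ω, Continuous fun t => X t ω
  /-- The transition probabilities depend measurably on the starting point. -/
  measurable_heatMeasure : ∀ (t : ℝ≥0) (E : Set M), MeasurableSet E →
    Measurable fun x => heatMeasure P X t x E
  /-- Time-homogeneous strong Markov property: for every stopping time `τ`,
  `P_x(X_{τ+s} ∈ E | F_τ) = μ_s^{X_τ}(E)` on `{τ < ∞}`, written out through the integrals over
  the sets `A ∈ F_τ`. -/
  strong_markov : ∀ (x : M) (τ : Ω → WithTop ℝ≥0) (hτ : IsStoppingTime F τ) (s : ℝ≥0)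
    (A : Set Ω) (E : Set M), MeasurableSet[hτ.measurableSpace] A → MeasurableSet E →
    P x (A ∩ {ω | τ ω < ⊤ ∧ X ((τ ω).untopA + s) ω ∈ E}) =
      ∫⁻ ω in A ∩ {ω | τ ω < ⊤}, heatMeasure P X s (X (τ ω).untopA ω) E ∂(P x)
  /-- Almost surely, `s ↦ (L f)(X_s)` is integrable on bounded time intervals. -/
  integrable_path : ∀ (f : C^2⟮𝓡 d, M; ℝ⟯) (x : M), ∀ᵐ ω ∂(P x), ∀ t : ℝ≥0,
    IntervalIntegrable (fun s : ℝ => L f (X s.toNNReal ω)) volume 0 t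
  /-- Martingale problem: `f(X_t) - ∫_0^t (L f)(X_s) ds` is a local martingale under every `P_x`,
  for every `f ∈ C²(M)`. -/
  local_martingale : ∀ (f : C^2⟮𝓡 d, M; ℝ⟯) (x : M),
    Locally (fun Y : ℝ≥0 → Ω → ℝ => Martingale Y F (P x)) F
      (fun (t : ℝ≥0) ω => f (X t ω) - ∫ s in (0 : ℝ)..t, L f (X s.toNNReal ω)) (P x)

/-- The process is uniformly local with parameter `δ`: there are `t, ε > 0` with
`P_x(d(x, X_s) ≤ δ) ≥ ε` for all `x` and all `0 ≤ s < t`. -/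
def UniformlyLocal {M Ω : Type*} [Dist M] [MeasurableSpace Ω]
    (P : M → Measure Ω) (X : ℝ≥0 → Ω → M) (δ : ℝ) : Prop :=
  ∃ t : ℝ≥0, 0 < t ∧ ∃ ε : ℝ, 0 < ε ∧
    ∀ x : M, ∀ s < t, ε ≤ (P x).real {ω | dist x (X s ω) ≤ δ}

/-! Stop the diffusion at the first time `ρ` at which its distance from the start x reaches n,
capped at t. Up to `ρ` the values f(X) are bounded, so the local martingale property and Lf ≥ 0 give
f(x) ≤ E_x f(X_ρ) (`le_integral_stopped`). On {ρ = t} the integrand is f(X_t), and letting n → ∞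
produces (e^{tL}f)(x) by dominated convergence. On {ρ < t} it is at most the supremum of |f| over
B(x,n), so the probability of this event must be small. Uniform locality provides this: after
reaching the sphere, X is at time t still within δ of the hitting point with conditional probability
at least ε, hence ε P_x(ρ < t) ≤ P_x(n-δ ≤ d(X_t,x) ≤ n+δ) (`mul_measure_lt_le`), and (B) makes the
product vanish in the limit.

This settles short times (`le_heatOperator_of_local`). Chapman-Kolmogorov iterates the inequality up
to T, with (A) supplying integrability. For Lf = 0 it applies to both f and -f. In either case of
(3), |f| ≤ e^{uL}|f| for u < T, and Jensen together with Chapman-Kolmogorov gives monotone moments.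

Stopping times are handled by approximation from above on a grid, which reduces everything to
countably many fixed times. -/

/-! ### Discretization of time -/

/-- The smallest point of the grid `ℕ / (j + 1)` above `s`, capped at `t`. -/
noncomputable def gridCeil (t : ℝ≥0) (j : ℕ) (s : ℝ≥0) : ℝ≥0 :=
  min t (⌈s * (j + 1)⌉₊ / (j + 1))

lemma gridCeil_le (t : ℝ≥0) (j : ℕ) (s : ℝ≥0) : gridCeil t j s ≤ t := min_le_left _ _

lemma le_gridCeil {t s : ℝ≥0} (h : s ≤ t) (j : ℕ) : s ≤ gridCeil t j s := by
  refine le_min h ?_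
  rw [le_div_iff₀ (by positivity)]
  exact Nat.le_ceil _

lemma gridCeil_le_add (t : ℝ≥0) (j : ℕ) (s : ℝ≥0) : gridCeil t j s ≤ s + 1 / (j + 1) := by
  refine (min_le_right _ _).trans ?_
  rw [div_le_iff₀ (by positivity), add_mul, div_mul_cancel₀ _ (by positivity)]
  exact (Nat.ceil_lt_add_one (zero_le)).le

lemma tendsto_gridCeil {t s : ℝ≥0} (h : s ≤ t) :
    Tendsto (fun j => gridCeil t j s) atTop (𝓝 s) := by
  have h1 : Tendsto (fun j : ℕ => s + 1 / ((j : ℝ≥0) + 1)) atTop (𝓝 (s + 0)) :=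
    tendsto_const_nhds.add tendsto_one_div_add_atTop_nhds_zero_nat
  rw [add_zero] at h1
  exact tendsto_of_tendsto_of_tendsto_of_le_of_le tendsto_const_nhds h1
    (fun j => le_gridCeil h j) (fun j => gridCeil_le_add t j s)

lemma countable_range_gridCeil (t : ℝ≥0) (j : ℕ) : (Set.range (gridCeil t j)).Countable := by
  refine (Set.countable_range fun n : ℕ => min t ((n : ℝ≥0) / (j + 1))).mono ?_
  rintro _ ⟨s, rfl⟩
  exact ⟨⌈s * (j + 1)⌉₊, rfl⟩

lemma gridCeil_le_iff {t u : ℝ≥0} (hu : u < t) (j : ℕ) (s : ℝ≥0) :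
    gridCeil t j s ≤ u ↔ s ≤ (⌊u * (j + 1)⌋₊ : ℝ≥0) / (j + 1) := by
  rw [gridCeil, min_le_iff, or_iff_right hu.not_ge, div_le_iff₀ (by positivity),
    le_div_iff₀ (by positivity), ← Nat.le_floor_iff zero_le, Nat.ceil_le]

/-! ### Optional stopping in continuous time -/

section Filtration

variable {Ω : Type*} {mΩ : MeasurableSpace Ω} {F : Filtration ℝ≥0 mΩ}

/-- Rounding up preserves stopping times: for u < t, the rounded time is at most u exactly when `ρ`
is at most the last grid point before u, an event already known at that earlier time. -/
lemma isStoppingTime_gridCeil {ρ : Ω → ℝ≥0} (hρ : IsStoppingTime F fun ω => (ρ ω : WithTop ℝ≥0))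
    (t : ℝ≥0) (j : ℕ) :
    IsStoppingTime F fun ω => (gridCeil t j (ρ ω) : WithTop ℝ≥0) := by
  intro u
  simp only [WithTop.coe_le_coe]
  rcases lt_or_ge u t with hu | hu
  · simp only [gridCeil_le_iff hu]
    have := hρ ((⌊u * (j + 1)⌋₊ : ℝ≥0) / (j + 1))
    simp only [WithTop.coe_le_coe] at this
    refine F.mono ?_ _ this
    rw [div_le_iff₀ (by positivity)]
    exact Nat.floor_le zero_le
  · have : {ω | gridCeil t j (ρ ω) ≤ u} = Set.univ :=
      Set.eq_univ_of_forall fun ω => (gridCeil_le t j _).trans hu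
    rw [this]
    exact MeasurableSet.univ

lemma measurable_of_isStoppingTime_coe {ρ : Ω → ℝ≥0}
    (hρ : IsStoppingTime F fun ω => (ρ ω : WithTop ℝ≥0)) : Measurable ρ := by
  refine measurable_of_Iic fun u => F.le u _ ?_
  have := hρ u
  simp only [WithTop.coe_le_coe] at this
  exact this

/-- Optional stopping for a martingale with almost surely continuous paths at a bounded stopping
time. -/
theorem MeasureTheory.Martingale.integral_stopped_eq_of_continuous {μ : Measure Ω}
    [IsFiniteMeasure μ] {N : ℝ≥0 → Ω → ℝ} (hN : Martingale N F μ) {ρ : Ω → ℝ≥0}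
    (hρ : IsStoppingTime F fun ω => (ρ ω : WithTop ℝ≥0)) {t : ℝ≥0} (hρt : ∀ ω, ρ ω ≤ t)
    (hc : ∀ᵐ ω ∂μ, Continuous fun s => N s ω) :
    Integrable (fun ω => N (ρ ω) ω) μ ∧ ∫ ω, N (ρ ω) ω ∂μ = ∫ ω, N 0 ω ∂μ := by
  have hst := isStoppingTime_gridCeil hρ t
  have hle : ∀ j ω, (gridCeil t j (ρ ω) : WithTop ℝ≥0) ≤ t := fun j ω =>
    WithTop.coe_le_coe.2 (gridCeil_le t j _)
  have hms : ∀ j, (hst j).measurableSpace ≤ mΩ := fun j =>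
    (hst j).measurableSpace_le_of_le (hle j)
  have hcond : ∀ j, (fun ω => N (gridCeil t j (ρ ω)) ω) =ᵐ[μ]
      μ[N t | (hst j).measurableSpace] := fun j => by
    refine hN.stoppedValue_ae_eq_condExp_of_le_const_of_countable_range (hst j) (hle j) ?_
    refine ((countable_range_gridCeil t j).image (fun s : ℝ≥0 => (s : WithTop ℝ≥0))).mono ?_
    rintro _ ⟨ω, rfl⟩
    exact ⟨_, ⟨ρ ω, rfl⟩, rfl⟩
  -- All discretized values are conditional expectations of the single variable `N t`; the resulting
  -- uniform integrability upgrades almost sure convergence to convergence in L¹.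
  have hUI : UniformIntegrable (fun j => μ[N t | (hst j).measurableSpace]) 1 μ :=
    (hN.integrable t).uniformIntegrable_condExp hms
  have hlim : ∀ᵐ ω ∂μ, Tendsto (fun j => (μ[N t | (hst j).measurableSpace]) ω) atTop
      (𝓝 (N (ρ ω) ω)) := by
    filter_upwards [hc, ae_all_iff.2 hcond] with ω hω hj
    simp only [← hj]
    exact (hω.tendsto (ρ ω)).comp (tendsto_gridCeil (hρt ω))
  have hmeas : ∀ j, AEStronglyMeasurable (μ[N t | (hst j).measurableSpace]) μ := fun j =>
    integrable_condExp.aestronglyMeasurable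
  have hLp : MemLp (fun ω => N (ρ ω) ω) 1 μ := hUI.memLp_of_ae_tendsto hlim
  have hint := memLp_one_iff_integrable.1 hLp
  refine ⟨hint, ?_⟩
  have h1 := tendsto_Lp_finite_of_tendsto_ae le_rfl ENNReal.one_ne_top hmeas hLp hUI.2.1 hlim
  have h2 : Tendsto (fun j => ∫ ω, (μ[N t | (hst j).measurableSpace]) ω ∂μ) atTop
      (𝓝 (∫ ω, N (ρ ω) ω ∂μ)) := by
    refine tendsto_integral_of_L1' _ hint.1 (Eventually.of_forall fun j => integrable_condExp) h1
  simp only [integral_condExp (hms _)] at h2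
  rw [tendsto_nhds_unique h2 tendsto_const_nhds]
  have := hN.setIntegral_eq (zero_le (a := t)) (MeasurableSet.univ)
  simpa using this.symm

end Filtration

/-! ### Hitting times of continuous paths -/

/-- The first time at which `g` reaches the level `r`, capped at `t`. -/
noncomputable def firstTime (g : ℝ≥0 → ℝ) (r : ℝ) (t : ℝ≥0) : ℝ≥0 :=
  sInf ({s | r ≤ g s} ∪ {t})

section firstTime

variable {g : ℝ≥0 → ℝ} {r : ℝ} {t : ℝ≥0}

lemma firstTime_le : firstTime g r t ≤ t := csInf_le (OrderBot.bddBelow _) (by simp)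

lemma firstTime_mem (hg : Continuous g) : firstTime g r t ∈ {s | r ≤ g s} ∪ {t} := by
  have hcl : IsClosed ({s | r ≤ g s} ∪ {t}) :=
    (isClosed_le continuous_const hg).union isClosed_singleton
  exact hcl.csInf_mem ⟨t, by simp⟩ (OrderBot.bddBelow _)

lemma le_apply_firstTime (hg : Continuous g) (h : firstTime g r t < t) :
    r ≤ g (firstTime g r t) :=
  (firstTime_mem hg).resolve_right h.ne

lemma lt_of_lt_firstTime {s : ℝ≥0} (h : s < firstTime g r t) : g s < r := by
  by_contra! hc
  exact h.not_ge (csInf_le (OrderBot.bddBelow _) (Or.inl hc))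

lemma apply_le_of_le_firstTime (hg : Continuous g) (h0 : g 0 ≤ r) {s : ℝ≥0}
    (h : s ≤ firstTime g r t) : g s ≤ r := by
  rcases h.lt_or_eq with h | rfl
  · exact (lt_of_lt_firstTime h).le
  -- At time zero there are no earlier times from which to pass to the limit; `h0` covers this case.
  rcases eq_zero_or_pos (firstTime g r t) with h | h
  · rwa [h]
  have hcl : IsClosed {s | g s ≤ r} := isClosed_le hg continuous_const
  have : Set.Iio (firstTime g r t) ⊆ {s | g s ≤ r} := fun s hs => (lt_of_lt_firstTime hs).le
  have h2 := hcl.closure_subset_iff.2 this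
  rw [closure_Iio' (Set.nonempty_of_mem (Set.mem_Iio.2 h))] at h2
  exact h2 (Set.mem_Iic.2 le_rfl)

lemma firstTime_eq (hg : Continuous g) (h : ∀ s ≤ t, g s < r) : firstTime g r t = t := by
  by_contra hne
  have hlt := lt_of_le_of_ne firstTime_le hne
  exact (h _ hlt.le).not_ge (le_apply_firstTime hg hlt)

lemma firstTime_le_iff (hg : Continuous g) {u : ℝ≥0} (hu : u < t) :
    firstTime g r t ≤ u ↔ ∃ s ≤ u, r ≤ g s := by
  constructor
  · intro h
    exact ⟨_, h, le_apply_firstTime hg (h.trans_lt hu)⟩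
  · rintro ⟨s, hs, hr⟩
    have : firstTime g r t ≤ s := csInf_le (OrderBot.bddBelow _) (Or.inl hr)
    exact this.trans hs

/-- A continuous path attains its maximum on the compact interval [0,u], so coming arbitrarily close
to the level forces reaching it. The condition becomes countable and involves only times up to u, so
the hitting time is a stopping time without right-continuity of the filtration. -/
lemma exists_le_iff_forall_denseSeq (hg : Continuous g) (u : ℝ≥0) :
    (∃ s ≤ u, r ≤ g s) ↔
      ∀ k : ℕ, ∃ i : ℕ, r - 1 / (k + 1) < g (TopologicalSpace.denseSeq (Set.Iic u) i) := by
  constructor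
  · rintro ⟨s, hs, hr⟩ k
    have ho : IsOpen {v : Set.Iic u | r - 1 / ((k : ℝ) + 1) < g v} :=
      isOpen_lt continuous_const (hg.comp continuous_subtype_val)
    have hpos : (0 : ℝ) < 1 / ((k : ℝ) + 1) := by positivity
    obtain ⟨v, hv, i, rfl⟩ := (TopologicalSpace.denseRange_denseSeq (Set.Iic u)).inter_open_nonempty
      _ ho ⟨⟨s, hs⟩, by simp only [Set.mem_ofPred_eq]; linarith⟩
    exact ⟨i, hv⟩
  · intro h
    have hcomp : IsCompact (Set.Iic u) := by
      rw [← Set.Icc_bot]; exact isCompact_Icc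
    obtain ⟨s, hs, hmax⟩ := hcomp.exists_isMaxOn ⟨u, Set.mem_Iic.2 le_rfl⟩ hg.continuousOn
    refine ⟨s, hs, ?_⟩
    by_contra! hlt
    obtain ⟨k, hk⟩ := exists_nat_one_div_lt (sub_pos.2 hlt)
    obtain ⟨i, hi⟩ := h k
    have := hmax (TopologicalSpace.denseSeq (Set.Iic u) i).2
    simp only [Set.mem_ofPred_eq] at this
    linarith

lemma isStoppingTime_firstTime {Ω : Type*} {mΩ : MeasurableSpace Ω} {F : Filtration ℝ≥0 mΩ}
    {Y : ℝ≥0 → Ω → ℝ} (hY : ∀ s, Measurable[F s] (Y s)) (hc : ∀ ω, Continuous fun s => Y s ω)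
    (r : ℝ) (t : ℝ≥0) :
    IsStoppingTime F fun ω => (firstTime (fun s => Y s ω) r t : WithTop ℝ≥0) := by
  intro u
  simp only [WithTop.coe_le_coe]
  rcases lt_or_ge u t with hu | hu
  · simp only [firstTime_le_iff (hc _) hu, exists_le_iff_forall_denseSeq (hc _) u]
    rw [Set.ofPred_forall]
    refine MeasurableSet.iInter fun k => ?_
    rw [Set.ofPred_exists]
    refine MeasurableSet.iUnion fun i => ?_
    refine measurableSet_lt measurable_const ?_
    exact (hY _).mono (F.mono (TopologicalSpace.denseSeq (Set.Iic u) i).2) le_rfl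
  · have : {ω | firstTime (fun s => Y s ω) r t ≤ u} = Set.univ :=
      Set.eq_univ_of_forall fun ω => firstTime_le.trans hu
    rw [this]
    exact MeasurableSet.univ

end firstTime

/-! ### Markov property and locality after a stopping time -/

namespace IsDiffusion

variable {d : ℕ} {M : Type*} [MetricSpace M] [ProperSpace M]
  [ChartedSpace (EuclideanSpace ℝ (Fin d)) M] [MeasurableSpace M] [BorelSpace M]
  {Ω : Type*} [mΩ : MeasurableSpace Ω] {L : C^2⟮𝓡 d, M; ℝ⟯ →ₗ[ℝ] (M → ℝ)}
  {F : Filtration ℝ≥0 mΩ} {X : ℝ≥0 → Ω → M} {P : M → Measure Ω}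

omit [ProperSpace M] [BorelSpace M] in
lemma measurable (hX : IsDiffusion L F X P) (t : ℝ≥0) : Measurable (X t) :=
  (hX.adapted t).mono (F.le t) le_rfl

omit [ProperSpace M] in
lemma measurable_stopped (hX : IsDiffusion L F X P) {ρ : Ω → ℝ≥0} (hρ : Measurable ρ) :
    Measurable fun ω => X (ρ ω) ω :=
  (measurable_uncurry_of_continuous_of_measurable hX.continuous_path hX.measurable).comp
    (hρ.prodMk measurable_id)

/-- The transition kernel of a diffusion. -/
noncomputable def kernel (hX : IsDiffusion L F X P) (t : ℝ≥0) : Kernel M M :=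
  ⟨heatMeasure P X t, Measure.measurable_of_measurable_coe _ (hX.measurable_heatMeasure t)⟩

omit [ProperSpace M] [BorelSpace M] in
lemma kernel_apply (hX : IsDiffusion L F X P) (t : ℝ≥0) (x : M) :
    hX.kernel t x = heatMeasure P X t x := rfl

omit [ProperSpace M] [BorelSpace M] in
lemma isProbabilityMeasure_heatMeasure (hX : IsDiffusion L F X P) (t : ℝ≥0) (x : M) :
    IsProbabilityMeasure (heatMeasure P X t x) :=
  have := hX.isProbabilityMeasure x
  Measure.isProbabilityMeasure_map (hX.measurable t).aemeasurable

omit [ProperSpace M] [BorelSpace M] in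
lemma isMarkovKernel_kernel (hX : IsDiffusion L F X P) (t : ℝ≥0) :
    IsMarkovKernel (hX.kernel t) :=
  ⟨fun x => hX.isProbabilityMeasure_heatMeasure t x⟩

omit [ProperSpace M] [BorelSpace M] in
lemma markov (hX : IsDiffusion L F X P) (x : M) (q s : ℝ≥0) {A : Set Ω}
    (hA : MeasurableSet[F q] A) {E : Set M} (hE : MeasurableSet E) :
    P x (A ∩ X (q + s) ⁻¹' E) = ∫⁻ ω in A, heatMeasure P X s (X q ω) E ∂(P x) := by
  have := hX.strong_markov x (fun _ => (q : WithTop ℝ≥0)) (isStoppingTime_const F q) s A E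
    (by rwa [IsStoppingTime.measurableSpace_const]) hE
  have hq : (WithTop.some q) < ⊤ := WithTop.coe_lt_top q
  simp only [hq, true_and, WithTop.untopD_coe, Set.ofPred_true, Set.inter_univ] at this
  exact this

-- Rectangles determine the joint law, and A ∩ {X_q ∈ E₁} still lies in F_q, so the fixed-time
-- Markov property decides each rectangle. The joint form is needed because d(X_q, X_{q+s}) ≤ δ is
-- not a rectangle event.
omit [ProperSpace M] [BorelSpace M] in
lemma map_prodMk_restrict (hX : IsDiffusion L F X P) (x : M) (q s : ℝ≥0) {A : Set Ω}
    (hA : MeasurableSet[F q] A) :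
    ((P x).restrict A).map (fun ω => (X q ω, X (q + s) ω)) =
      (((P x).restrict A).map (X q)) ⊗ₘ hX.kernel s := by
  have := hX.isProbabilityMeasure x
  have := hX.isMarkovKernel_kernel s
  have hm := (hX.measurable q).prodMk (hX.measurable (q + s))
  refine Measure.ext_prod fun {E₁ E₂} h₁ h₂ => ?_
  have hpre : MeasurableSet[F q] (A ∩ X q ⁻¹' E₁) := hA.inter (hX.adapted q h₁)
  rw [Measure.map_apply hm (h₁.prod h₂), Measure.compProd_apply_prod h₁ h₂,
    Measure.restrict_map (hX.measurable q) h₁,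
    lintegral_map ((hX.kernel s).measurable_coe h₂) (hX.measurable q),
    Measure.restrict_restrict (hX.measurable q h₁), Set.inter_comm (X q ⁻¹' E₁)]
  simp only [kernel_apply]
  rw [← hX.markov x q s hpre h₂, Measure.restrict_apply (hm (h₁.prod h₂))]
  congr 1
  ext ω
  simp only [Set.mem_inter_iff, Set.mem_preimage, Set.mem_prod]
  tauto

omit [ProperSpace M] [BorelSpace M] in
/-- The **Chapman-Kolmogorov equation**. -/
lemma heatMeasure_add (hX : IsDiffusion L F X P) (x : M) (q s : ℝ≥0) :
    heatMeasure P X (q + s) x = (heatMeasure P X q x).bind (hX.kernel s) := by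
  ext E hE
  rw [Measure.bind_apply hE (hX.kernel s).aemeasurable, heatMeasure, heatMeasure,
    Measure.map_apply (hX.measurable _) hE,
    lintegral_map ((hX.kernel s).measurable_coe hE) (hX.measurable q)]
  simpa [kernel_apply] using hX.markov x q s MeasurableSet.univ hE

/-- Conditionally on X_q, the probability of moving by at most δ during time s is the kernel mass of
a ball around X_q, which is at least ε. -/
lemma mul_measure_le (hX : IsDiffusion L F X P) (x : M) (q s : ℝ≥0) {A : Set Ω}
    (hA : MeasurableSet[F q] A) {δ : ℝ} {ε : ℝ≥0∞}
    (hε : ∀ z, ε ≤ P z {ω | dist z (X s ω) ≤ δ}) :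
    ε * P x A ≤ P x (A ∩ {ω | dist (X q ω) (X (q + s) ω) ≤ δ}) := by
  have := hX.isProbabilityMeasure x
  have := hX.isMarkovKernel_kernel s
  have hm := (hX.measurable q).prodMk (hX.measurable (q + s))
  have hD : MeasurableSet {z : M × M | dist z.1 z.2 ≤ δ} :=
    measurableSet_le measurable_dist measurable_const
  have h := congrArg (fun μ => μ {z : M × M | dist z.1 z.2 ≤ δ})
    (hX.map_prodMk_restrict x q s hA)
  simp only [Measure.map_apply hm hD, Measure.compProd_apply hD] at h
  rw [Measure.restrict_apply (hm hD), lintegral_map (Kernel.measurable_kernel_prodMk_left hD)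
    (hX.measurable q), Set.inter_comm] at h
  refine le_trans ?_ h.ge
  have hle : ∫⁻ _ in A, ε ∂(P x) ≤
      ∫⁻ ω in A, hX.kernel s (X q ω) (Prod.mk (X q ω) ⁻¹' {z : M × M | dist z.1 z.2 ≤ δ}) ∂(P x) := by
    refine lintegral_mono fun ω => ?_
    refine (hε (X q ω)).trans ?_
    rw [kernel_apply, heatMeasure, Measure.map_apply (hX.measurable s) (measurable_prodMk_left hD)]
    rfl
  simpa using hle

/-- Split {ρ < t} into the countably many events {ρ = q}, each in F_q, and use the fixed-time bound
with remaining time t - q ≤ t. -/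
lemma mul_measure_lt_le_of_countable (hX : IsDiffusion L F X P) (x : M) {t : ℝ≥0} {ρ : Ω → ℝ≥0}
    (hρ : IsStoppingTime F fun ω => (ρ ω : WithTop ℝ≥0)) (hc : (Set.range ρ).Countable)
    {δ : ℝ} {ε : ℝ≥0∞} (hε : ∀ z, ∀ s ≤ t, ε ≤ P z {ω | dist z (X s ω) ≤ δ}) :
    ε * P x {ω | ρ ω < t} ≤ P x ({ω | ρ ω < t} ∩ {ω | dist (X (ρ ω) ω) (X t ω) ≤ δ}) := by
  have hS : (Set.range ρ ∩ Set.Iio t).Countable := hc.mono Set.inter_subset_left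
  have hmeas : ∀ q, MeasurableSet[F q] {ω | ρ ω = q} := fun q => by
    have := hρ.measurableSet_eq q
    simpa only [WithTop.coe_inj] using this
  have hD : MeasurableSet {ω | dist (X (ρ ω) ω) (X t ω) ≤ δ} :=
    measurableSet_le ((hX.measurable_stopped (measurable_of_isStoppingTime_coe hρ)).dist
      (hX.measurable t)) measurable_const
  have hU : {ω | ρ ω < t} = ⋃ q ∈ Set.range ρ ∩ Set.Iio t, {ω | ρ ω = q} := by
    ext ω; simp
  have hdisj : (Set.range ρ ∩ Set.Iio t).PairwiseDisjoint fun q => {ω | ρ ω = q} := by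
    intro a _ b _ hab
    refine Set.disjoint_left.2 fun ω h1 h2 => hab ?_
    exact (h1 : ρ ω = a).symm.trans h2
  rw [hU, Set.iUnion₂_inter, measure_biUnion hS hdisj fun q _ => F.le q _ (hmeas q),
    measure_biUnion hS (hdisj.mono fun q => Set.inter_subset_left)
      fun q _ => (F.le q _ (hmeas q)).inter hD, ← ENNReal.tsum_mul_left]
  refine ENNReal.tsum_le_tsum fun q => ?_
  have hq : (q : ℝ≥0) + (t - q) = t := add_tsub_cancel_of_le q.2.2.le
  refine (hX.mul_measure_le x q (t - q) (hmeas q) fun z => hε z _ tsub_le_self).trans ?_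
  refine measure_mono fun ω hω => ⟨hω.1, ?_⟩
  have h1 : ρ ω = q := hω.1
  have h2 := hω.2
  simp only [Set.mem_ofPred_eq, hq] at h2
  simpa only [Set.mem_ofPred_eq, h1] using h2

/-- If the process stays `δ`-close to its starting point with probability at least `ε` during time
`t`, then on `{ρ < t}` it is at time `t` still `δ`-close to its position at the stopping time
`ρ`, with conditional probability at least `ε`. -/
theorem mul_measure_lt_le (hX : IsDiffusion L F X P) (x : M) {t : ℝ≥0} {ρ : Ω → ℝ≥0}
    (hρ : IsStoppingTime F fun ω => (ρ ω : WithTop ℝ≥0)) (hρt : ∀ ω, ρ ω ≤ t)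
    {δ : ℝ} {ε : ℝ≥0∞} (hε_top : ε ≠ ∞)
    (hε : ∀ z, ∀ s ≤ t, ε ≤ P z {ω | dist z (X s ω) ≤ δ}) :
    ε * P x {ω | ρ ω < t} ≤ P x ({ω | ρ ω < t} ∩ {ω | dist (X (ρ ω) ω) (X t ω) ≤ δ}) := by
  have := hX.isProbabilityMeasure x
  have hst := isStoppingTime_gridCeil hρ t
  have hmρ := measurable_of_isStoppingTime_coe hρ
  have hmj := fun j => measurable_of_isStoppingTime_coe (hst j)
  have hlim : ∀ ω, Tendsto (fun j => gridCeil t j (ρ ω)) atTop (𝓝 (ρ ω)) := fun ω =>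
    tendsto_gridCeil (hρt ω)
  have hD : ∀ {τ : Ω → ℝ≥0}, Measurable τ →
      MeasurableSet ({ω | τ ω < t} ∩ {ω | dist (X (τ ω) ω) (X t ω) ≤ δ}) := fun hτ =>
    (measurableSet_lt hτ measurable_const).inter
      (measurableSet_le ((hX.measurable_stopped hτ).dist (hX.measurable t)) measurable_const)
  set B := {ω | ρ ω < t} ∩ {ω | dist (X (ρ ω) ω) (X t ω) ≤ δ} with hB
  set Bj : ℕ → Set Ω := fun j => {ω | gridCeil t j (ρ ω) < t} ∩
    {ω | dist (X (gridCeil t j (ρ ω)) ω) (X t ω) ≤ δ} with hBj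
  -- The events `Bj j` need not converge to `B`, since the limit distance may equal δ. Only their
  -- excess over `B` has to vanish, and off `B` a path eventually leaves `Bj j`.
  have hj : ∀ j, ε * P x {ω | gridCeil t j (ρ ω) < t} ≤ P x B + P x (Bj j \ B) := fun j => by
    refine (hX.mul_measure_lt_le_of_countable x (hst j) ?_ hε).trans ?_
    · refine (countable_range_gridCeil t j).mono ?_
      rintro _ ⟨ω, rfl⟩
      exact ⟨ρ ω, rfl⟩
    · refine (measure_mono ?_).trans (measure_union_le _ _)
      intro ω hω
      by_cases h : ω ∈ B
      · exact Or.inl h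
      · exact Or.inr ⟨hω, h⟩
  have h1 : Tendsto (fun j => P x {ω | gridCeil t j (ρ ω) < t}) atTop
      (𝓝 (P x {ω | ρ ω < t})) := by
    refine tendsto_measure_of_tendsto_indicator_of_isFiniteMeasure atTop (P x)
      (fun j => measurableSet_lt (hmj j) measurable_const) fun ω => ?_
    by_cases h : ρ ω < t
    · filter_upwards [(hlim ω).eventually_lt_const h] with j hj
      simp [h, hj]
    · refine Eventually.of_forall fun j => ?_
      simp only [Set.mem_ofPred_eq, h, iff_false, not_lt]
      exact (not_lt.1 h).trans (le_gridCeil (hρt ω) j)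
  have h2 : Tendsto (fun j => P x (Bj j \ B)) atTop (𝓝 (P x ∅)) := by
    refine tendsto_measure_of_tendsto_indicator_of_isFiniteMeasure atTop (P x)
      (fun j => (hD (hmj j)).diff (hD hmρ)) fun ω => ?_
    by_cases h : ρ ω < t
    · by_cases h' : dist (X (ρ ω) ω) (X t ω) ≤ δ
      · refine Eventually.of_forall fun j => ?_
        simp [hB, h, h']
      · have hd : Tendsto (fun j => dist (X (gridCeil t j (ρ ω)) ω) (X t ω)) atTop
            (𝓝 (dist (X (ρ ω) ω) (X t ω))) :=
          (((hX.continuous_path ω).tendsto _).comp (hlim ω)).dist tendsto_const_nhds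
        filter_upwards [hd.eventually_const_lt (not_le.1 h')] with j hj
        simp [hBj, hj]
    · refine Eventually.of_forall fun j => ?_
      have : ¬ gridCeil t j (ρ ω) < t :=
        not_lt.2 ((not_lt.1 h).trans (le_gridCeil (hρt ω) j))
      simp [hBj, this]
  rw [measure_empty] at h2
  have h3 := le_of_tendsto_of_tendsto' (ENNReal.Tendsto.const_mul h1 (Or.inr hε_top))
    (tendsto_const_nhds.add h2) hj
  rwa [add_zero] at h3

end IsDiffusion

/-! ### Stopping the local martingale -/

namespace IsDiffusion

variable {d : ℕ} {M : Type*} [MetricSpace M] [ProperSpace M]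
  [ChartedSpace (EuclideanSpace ℝ (Fin d)) M] [MeasurableSpace M] [BorelSpace M]
  {Ω : Type*} [mΩ : MeasurableSpace Ω] {L : C^2⟮𝓡 d, M; ℝ⟯ →ₗ[ℝ] (M → ℝ)}
  {F : Filtration ℝ≥0 mΩ} {X : ℝ≥0 → Ω → M} {P : M → Measure Ω}

omit [ProperSpace M] [BorelSpace M] in
lemma ae_continuous_martingale (hX : IsDiffusion L F X P) (f : C^2⟮𝓡 d, M; ℝ⟯) (x : M) :
    ∀ᵐ ω ∂(P x), Continuous fun t : ℝ≥0 =>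
      f (X t ω) - ∫ s in (0 : ℝ)..t, L f (X s.toNNReal ω) := by
  filter_upwards [hX.integrable_path f x] with ω hω
  have h0 : ∀ a : ℝ, IntervalIntegrable (fun s : ℝ => L f (X s.toNNReal ω)) volume 0 a := by
    intro a
    rcases le_total 0 a with ha | ha
    · simpa [Real.coe_toNNReal a ha] using hω a.toNNReal
    -- At negative times `toNNReal` is zero, so the integrand is constant; integrability thus
    -- extends to the whole line, as continuity of the primitive requires.
    · refine (intervalIntegrable_const (c := L f (X 0 ω))).congr ?_
      intro s hs
      rw [Set.uIoc_of_ge ha] at hs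
      simp [Real.toNNReal_of_nonpos hs.2]
  have hc := intervalIntegral.continuous_primitive (fun a b => (h0 a).symm.trans (h0 b)) 0
  exact (f.contMDiff.continuous.comp (hX.continuous_path ω)).sub (hc.comp NNReal.continuous_coe)

lemma _root_.WithTop.untopA_some {α : Type*} [Nonempty α] (a : α) :
    (WithTop.some a).untopA = a := rfl

lemma _root_.WithTop.continuous_untopA_min (σ : WithTop ℝ≥0) :
    Continuous fun s : ℝ≥0 => (min (s : WithTop ℝ≥0) σ).untopA := by
  induction σ using WithTop.recTopCoe with
  | top => simpa only [min_top_right, WithTop.untopA_some] using continuous_id'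
  | coe a =>
    have : (fun s : ℝ≥0 => (min (s : WithTop ℝ≥0) (a : WithTop ℝ≥0)).untopA) =
        fun s => min s a := by
      funext s
      rw [← WithTop.coe_min, WithTop.untopA_some]
    rw [this]
    exact continuous_id.min continuous_const

lemma _root_.WithTop.coe_untopA_min (s : ℝ≥0) (σ : WithTop ℝ≥0) :
    ((min (s : WithTop ℝ≥0) σ).untopA : WithTop ℝ≥0) = min (s : WithTop ℝ≥0) σ :=
  by rw [WithTop.untopA_eq_untop ((min_le_left _ _).trans_lt (WithTop.coe_lt_top s)).ne, WithTop.coe_untop]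

omit [ProperSpace M] in
/-- If `L f ≥ 0`, then `f x ≤ E_x f(X_ρ)` for every bounded stopping time `ρ` up to which
`f(X)` is bounded. -/
theorem le_integral_stopped (hX : IsDiffusion L F X P) (f : C^2⟮𝓡 d, M; ℝ⟯)
    (hL : ∀ y, 0 ≤ L f y) (x : M) {t : ℝ≥0} {ρ : Ω → ℝ≥0}
    (hρ : IsStoppingTime F fun ω => (ρ ω : WithTop ℝ≥0)) (hρt : ∀ ω, ρ ω ≤ t) {C : ℝ}
    (hC : ∀ᵐ ω ∂(P x), ∀ s ≤ ρ ω, |f (X s ω)| ≤ C) :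
    f x ≤ ∫ ω, f (X (ρ ω) ω) ∂(P x) := by
  have := hX.isProbabilityMeasure x
  have hfm : Measurable f := f.contMDiff.continuous.measurable
  obtain ⟨σ, hσ, hmart⟩ := hX.local_martingale f x
  set Y : ℝ≥0 → Ω → ℝ := fun t ω => f (X t ω) - ∫ s in (0 : ℝ)..t, L f (X s.toNNReal ω) with hY
  have hpos : ∀ k, MeasurableSet {ω | ⊥ < σ k ω} := fun k => by
    have h1 := F.le 0 _ ((hσ.isStoppingTime k).measurableSet_le 0)
    have h2 : {ω | ⊥ < σ k ω} = {ω | σ k ω ≤ ((0 : ℝ≥0) : WithTop ℝ≥0)}ᶜ := by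
      ext ω
      exact (not_le (a := σ k ω) (b := ((0 : ℝ≥0) : WithTop ℝ≥0))).symm
    rw [h2]
    exact h1.compl
  have hmin : ∀ k, IsStoppingTime F
      fun ω => ((min (ρ ω : WithTop ℝ≥0) (σ k ω)).untopA : WithTop ℝ≥0) := fun k => by
    simp only [WithTop.coe_untopA_min]
    exact hρ.min (hσ.isStoppingTime k)
  -- Localization sets the process to zero where `σ k` vanishes, hence the indicator. Since almost
  -- surely `σ k` eventually exceeds `ρ`, both the indicator and the truncation disappear in the
  -- limit.
  set G : ℕ → Ω → ℝ := fun k => {ω | ⊥ < σ k ω}.indicator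
    fun ω => f (X (min (ρ ω : WithTop ℝ≥0) (σ k ω)).untopA ω) with hG
  have hGm : ∀ k, Measurable (G k) := fun k =>
    (hfm.comp (hX.measurable_stopped (measurable_of_isStoppingTime_coe (hmin k)))).indicator
      (hpos k)
  have hGb : ∀ k, ∀ᵐ ω ∂(P x), ‖G k ω‖ ≤ |C| := fun k => by
    filter_upwards [hC] with ω hω
    refine (norm_indicator_le_norm_self _ _).trans ((hω _ ?_).trans (le_abs_self C))
    rw [← WithTop.coe_le_coe, WithTop.coe_untopA_min]
    exact min_le_left _ _
  have hev : ∀ᵐ ω ∂(P x), ∀ᶠ k in atTop, (ρ ω : WithTop ℝ≥0) < σ k ω := by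
    filter_upwards [hσ.tendsto_top] with ω hω
    exact hω.eventually_const_lt (WithTop.coe_lt_top _)
  have hstep : ∀ k, ∫ ω, {ω | ⊥ < σ k ω}.indicator (fun _ => f x) ω ∂(P x) ≤
      ∫ ω, G k ω ∂(P x) := fun k => by
    have hcont : ∀ᵐ ω ∂(P x), Continuous fun s =>
        stoppedProcess (fun i => {ω | ⊥ < σ k ω}.indicator (Y i)) (σ k) s ω := by
      filter_upwards [hX.ae_continuous_martingale f x] with ω hω
      have h1 := hω.comp (WithTop.continuous_untopA_min (σ k ω))
      by_cases h : ω ∈ {ω | ⊥ < σ k ω}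
      · simpa only [stoppedProcess, Set.indicator_of_mem h, hY, Function.comp_def] using h1
      · simpa only [stoppedProcess, Set.indicator_of_notMem h] using continuous_const
    obtain ⟨hint, heq⟩ := (hmart k).integral_stopped_eq_of_continuous hρ hρt hcont
    have h0 : ∫ ω, {ω | ⊥ < σ k ω}.indicator (fun _ => f x) ω ∂(P x) =
        ∫ ω, stoppedProcess (fun i => {ω | ⊥ < σ k ω}.indicator (Y i)) (σ k) 0 ω ∂(P x) := by
      refine integral_congr_ae ?_
      filter_upwards [hX.start x] with ω hω
      have : (min ((0 : ℝ≥0) : WithTop ℝ≥0) (σ k ω)).untopA = 0 := by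
        have h0 : ((0 : ℝ≥0) : WithTop ℝ≥0) ≤ σ k ω := bot_le
        rw [min_eq_left h0, WithTop.untopA_some]
      simp only [stoppedProcess, this]
      by_cases h : ω ∈ {ω | ⊥ < σ k ω}
      · rw [Set.indicator_of_mem h, Set.indicator_of_mem h]
        simp [hY, hω]
      · simp only [Set.indicator_of_notMem h]
    rw [h0, ← heq]
    refine integral_mono hint ((memLp_top_of_bound (hGm k).aestronglyMeasurable _
      (hGb k)).integrable le_top) fun ω => ?_
    refine Set.indicator_le_indicator ?_
    -- The drift integral is nonnegative, so dropping it only increases the value.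
    simp only [hY, tsub_le_iff_right, le_add_iff_nonneg_right]
    exact intervalIntegral.integral_nonneg (NNReal.coe_nonneg _) fun s _ => hL _
  have h1 : Tendsto (fun k => ∫ ω, {ω | ⊥ < σ k ω}.indicator (fun _ => f x) ω ∂(P x)) atTop
      (𝓝 (∫ _, f x ∂(P x))) := by
    refine tendsto_integral_of_dominated_convergence (fun _ => |f x|)
      (fun k => (measurable_const.indicator (hpos k)).aestronglyMeasurable)
      (integrable_const _) (fun k => Eventually.of_forall fun ω =>
        norm_indicator_le_norm_self _ _) ?_
    filter_upwards [hev] with ω hω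
    refine tendsto_const_nhds.congr' ?_
    filter_upwards [hω] with k hk
    rw [Set.indicator_of_mem]
    exact bot_le.trans_lt hk
  have h2 : Tendsto (fun k => ∫ ω, G k ω ∂(P x)) atTop (𝓝 (∫ ω, f (X (ρ ω) ω) ∂(P x))) := by
    refine tendsto_integral_of_dominated_convergence (fun _ => |C|)
      (fun k => (hGm k).aestronglyMeasurable) (integrable_const _) hGb ?_
    filter_upwards [hev] with ω hω
    refine tendsto_const_nhds.congr' ?_
    filter_upwards [hω] with k hk
    have hk' : ω ∈ {ω | ⊥ < σ k ω} := bot_le.trans_lt hk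
    simp only [hG]
    rw [Set.indicator_of_mem hk', min_eq_left hk.le, WithTop.untopA_some]
  simpa using le_of_tendsto_of_tendsto' h1 h2 hstep

end IsDiffusion

/-! ### Exit probabilities and the short-time inequality -/

namespace IsDiffusion

variable {d : ℕ} {M : Type*} [MetricSpace M] [ProperSpace M]
  [ChartedSpace (EuclideanSpace ℝ (Fin d)) M] [MeasurableSpace M] [BorelSpace M]
  {Ω : Type*} [mΩ : MeasurableSpace Ω] {L : C^2⟮𝓡 d, M; ℝ⟯ →ₗ[ℝ] (M → ℝ)}
  {F : Filtration ℝ≥0 mΩ} {X : ℝ≥0 → Ω → M} {P : M → Measure Ω}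

/-- The probability of reaching the sphere of radius `r` around the starting point before time `t`
is controlled by the probability of lying in an annulus at time `t`. -/
lemma mul_measureReal_firstTime_lt_le (hX : IsDiffusion L F X P) (x : M) {t : ℝ≥0} {δ ε r : ℝ}
    (hr : 0 ≤ r) (hε0 : 0 ≤ ε)
    (hε : ∀ z, ∀ s ≤ t, ε ≤ (P z).real {ω | dist z (X s ω) ≤ δ}) :
    ε * (P x).real {ω | firstTime (fun s => dist (X s ω) x) r t < t} ≤
      (P x).real {ω | r - δ ≤ dist (X t ω) x ∧ dist (X t ω) x ≤ r + δ} := by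
  have hp := hX.isProbabilityMeasure
  have hcont : ∀ ω, Continuous fun s => dist (X s ω) x := fun ω =>
    (hX.continuous_path ω).dist continuous_const
  have hρ := isStoppingTime_firstTime (Y := fun s ω => dist (X s ω) x)
    (fun s => (measurable_id.dist measurable_const).comp (hX.adapted s)) hcont r t
  have h1 := hX.mul_measure_lt_le x hρ (fun ω => firstTime_le) (δ := δ) (ε := ENNReal.ofReal ε)
    ENNReal.ofReal_ne_top fun z s hs => by
      rw [ENNReal.ofReal_le_iff_le_toReal (measure_ne_top _ _)]
      exact hε z s hs
  have h2 : P x ({ω | firstTime (fun s => dist (X s ω) x) r t < t} ∩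
      {ω | dist (X (firstTime (fun s => dist (X s ω) x) r t) ω) (X t ω) ≤ δ}) ≤
      P x {ω | r - δ ≤ dist (X t ω) x ∧ dist (X t ω) x ≤ r + δ} := by
    refine measure_mono_ae ?_
    filter_upwards [hX.start x] with ω hω hmem
    obtain ⟨hlt, hd⟩ := hmem
    simp only [Set.mem_ofPred_eq] at hlt hd
    -- By continuity the stopped path lies at distance exactly r from x, so the triangle inequality
    -- puts X_t in the annulus.
    have hge := le_apply_firstTime (hcont ω) hlt
    have hle := apply_le_of_le_firstTime (hcont ω) (by simpa [hω] using hr) (t := t) le_rfl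
    have t1 := dist_triangle_left (X t ω) x (X (firstTime (fun s => dist (X s ω) x) r t) ω)
    have t2 := dist_triangle (X (firstTime (fun s => dist (X s ω) x) r t) ω) (X t ω) x
    exact ⟨by linarith, by linarith⟩
  have h3 := ENNReal.toReal_mono (measure_ne_top _ _) (h1.trans h2)
  rwa [ENNReal.toReal_mul, ENNReal.toReal_ofReal hε0] at h3

/-- If `L f ≥ 0`, then `f ≤ e^{tL} f` for times `t` during which the process is uniformly
local. -/
theorem le_heatOperator_of_local (hX : IsDiffusion L F X P) (f : C^2⟮𝓡 d, M; ℝ⟯)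
    (hL : ∀ y, 0 ≤ L f y) (x : M) {t : ℝ≥0} {δ ε θ : ℝ} (hε0 : 0 < ε) (hθ : θ ≤ 1)
    (hε : ∀ z, ∀ s ≤ t, ε ≤ (P z).real {ω | dist z (X s ω) ≤ δ})
    (hint : Integrable f (heatMeasure P X t x))
    (hB : Tendsto (fun n : ℕ => sSup ((fun y => |f y|) '' Metric.closedBall x n) *
      (P x).real {ω | n - δ ≤ dist (X t ω) x ∧ dist (X t ω) x ≤ n + δ} ^ θ) atTop (𝓝 0)) :
    f x ≤ heatOperator P X t f x := by
  have := hX.isProbabilityMeasure x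
  have hfc : Continuous f := f.contMDiff.continuous
  have hcont : ∀ ω, Continuous fun s => dist (X s ω) x := fun ω =>
    (hX.continuous_path ω).dist continuous_const
  set ρ : ℕ → Ω → ℝ≥0 := fun n ω => firstTime (fun s => dist (X s ω) x) n t
  have hρ : ∀ n, IsStoppingTime F fun ω => (ρ n ω : WithTop ℝ≥0) := fun n =>
    isStoppingTime_firstTime (Y := fun s ω => dist (X s ω) x)
      (fun s => (measurable_id.dist measurable_const).comp (hX.adapted s)) hcont n t
  have hρm := fun n => measurable_of_isStoppingTime_coe (hρ n)
  set C : ℕ → ℝ := fun n => sSup ((fun y => |f y|) '' Metric.closedBall x n)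
  have hC : ∀ n : ℕ, ∀ y, dist y x ≤ n → |f y| ≤ C n := fun n y hy => by
    refine le_csSup ?_ ⟨y, hy, rfl⟩
    exact ((isCompact_closedBall x (n : ℝ)).image hfc.abs).bddAbove
  have hC0 : ∀ n, 0 ≤ C n := fun n => (abs_nonneg (f x)).trans (hC n x (by simp))
  have hdist : ∀ n : ℕ, ∀ᵐ ω ∂(P x), ∀ s ≤ ρ n ω, |f (X s ω)| ≤ C n := fun n => by
    filter_upwards [hX.start x] with ω hω s hs
    exact hC n _ (apply_le_of_le_firstTime (hcont ω) (by simp [hω]) hs)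
  have hintX : Integrable (fun ω => f (X t ω)) (P x) :=
    hint.comp_measurable (hX.measurable t)
  have hmt : ∀ n, MeasurableSet {ω | ρ n ω = t} := fun n => (hρm n) (measurableSet_singleton t)
  have hml : ∀ n, MeasurableSet {ω | ρ n ω < t} := fun n =>
    measurableSet_lt (hρm n) measurable_const
  have hstep : ∀ n, f x ≤ ∫ ω, {ω | ρ n ω = t}.indicator (fun ω => f (X t ω)) ω ∂(P x) +
      C n * (P x).real {ω | ρ n ω < t} := fun n => by
    have hi1 : Integrable ({ω | ρ n ω = t}.indicator fun ω => f (X t ω)) (P x) :=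
      hintX.indicator (hmt n)
    have hi2 : Integrable ({ω | ρ n ω < t}.indicator fun _ => C n) (P x) :=
      (integrable_const _).indicator (hml n)
    refine (hX.le_integral_stopped f hL x (hρ n) (fun ω => firstTime_le) (hdist n)).trans ?_
    have : C n * (P x).real {ω | ρ n ω < t} =
        ∫ ω, {ω | ρ n ω < t}.indicator (fun _ => C n) ω ∂(P x) := by
      rw [integral_indicator (hml n), setIntegral_const, smul_eq_mul, mul_comm]
    rw [this, ← integral_add hi1 hi2]
    refine integral_mono_ae ?_ (hi1.add hi2) ?_
    · refine (memLp_top_of_bound (C := C n) (hfc.measurable.comp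
        (hX.measurable_stopped (hρm n))).aestronglyMeasurable ?_).integrable le_top
      filter_upwards [hdist n] with ω hω using hω _ le_rfl
    · filter_upwards [hdist n] with ω hω
      rcases (firstTime_le : ρ n ω ≤ t).lt_or_eq with h | h
      · have h' : ω ∉ {ω | ρ n ω = t} := h.ne
        have h'' : ω ∈ {ω | ρ n ω < t} := h
        simp only [Set.indicator_of_notMem h', Set.indicator_of_mem h'', zero_add]
        exact (le_abs_self _).trans (hω _ le_rfl)
      · have h' : ω ∈ {ω | ρ n ω = t} := h
        have h'' : ω ∉ {ω | ρ n ω < t} := h.not_lt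
        have h''' : ρ n ω = t := h
        simp only [Set.indicator_of_mem h', Set.indicator_of_notMem h'', add_zero, h''', le_refl]
  have h1 : Tendsto (fun n => ∫ ω, {ω | ρ n ω = t}.indicator (fun ω => f (X t ω)) ω ∂(P x)) atTop
      (𝓝 (∫ ω, f (X t ω) ∂(P x))) := by
    refine tendsto_integral_of_dominated_convergence (fun ω => ‖f (X t ω)‖)
      (fun n => (hintX.indicator (hmt n)).aestronglyMeasurable) hintX.norm
      (fun n => Eventually.of_forall fun ω => norm_indicator_le_norm_self _ _)
      (Eventually.of_forall fun ω => ?_)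
    refine tendsto_const_nhds.congr' ?_
    -- Each path is bounded on [0,t], so it never reaches level n for large n and the stopping time
    -- is then t.
    obtain ⟨R, hR⟩ := (isCompact_Icc (a := 0) (b := t)).bddAbove_image (hcont ω).continuousOn
    obtain ⟨N, hN⟩ := exists_nat_gt R
    filter_upwards [eventually_ge_atTop N] with n hn
    have h' : ω ∈ {ω | ρ n ω = t} := by
      refine firstTime_eq (hcont ω) fun s hs => ?_
      refine (hR ⟨s, ⟨zero_le, hs⟩, rfl⟩).trans_lt (hN.trans_le ?_)
      exact_mod_cast hn
    rw [Set.indicator_of_mem h']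
  have h2 : Tendsto (fun n => C n * (P x).real {ω | ρ n ω < t}) atTop (𝓝 0) := by
    have hB' := hB.const_mul ε⁻¹
    rw [mul_zero] at hB'
    refine squeeze_zero (fun n => mul_nonneg (hC0 n) measureReal_nonneg) (fun n => ?_) hB'
    have h3 := hX.mul_measureReal_firstTime_lt_le x (t := t) (Nat.cast_nonneg n) hε0.le hε
    rw [← le_inv_mul_iff₀ hε0] at h3
    -- A probability is at most its power with exponent θ ≤ 1, so the decay in `hB` is stronger than
    -- needed here.
    have h4 := Real.self_le_rpow_of_le_one (measureReal_nonneg (μ := P x) (s := {ω |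
      (n : ℝ) - δ ≤ dist (X t ω) x ∧ dist (X t ω) x ≤ n + δ})) measureReal_le_one hθ
    calc C n * (P x).real {ω | ρ n ω < t} ≤ C n * (ε⁻¹ * (P x).real {ω |
          (n : ℝ) - δ ≤ dist (X t ω) x ∧ dist (X t ω) x ≤ n + δ} ^ θ) := by
          refine mul_le_mul_of_nonneg_left (h3.trans ?_) (hC0 n)
          exact mul_le_mul_of_nonneg_left h4 (inv_nonneg.2 hε0.le)
      _ = _ := by ring
  have h3 := ge_of_tendsto' (h1.add h2) hstep
  rwa [add_zero, ← integral_map (hX.measurable t).aemeasurable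
    hfc.measurable.aestronglyMeasurable] at h3

/-! ### Semigroup property, iteration in time and moments -/

omit [ProperSpace M] [BorelSpace M] in
lemma heatOperator_zero (hX : IsDiffusion L F X P) {f : M → ℝ} (hf : Measurable f) (x : M) :
    heatOperator P X 0 f x = f x := by
  have := hX.isProbabilityMeasure x
  rw [heatOperator, heatMeasure, integral_map (hX.measurable 0).aemeasurable
    hf.aestronglyMeasurable, integral_congr_ae (g := fun _ => f x)]
  · simp
  · filter_upwards [hX.start x] with ω hω
    rw [hω]

omit [ProperSpace M] [BorelSpace M] in
lemma heatOperator_add (hX : IsDiffusion L F X P) {f : M → ℝ} (x : M) {q s : ℝ≥0}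
    (hf : Integrable f (heatMeasure P X (q + s) x)) :
    heatOperator P X (q + s) f x = heatOperator P X q (heatOperator P X s f) x ∧
      Integrable (heatOperator P X s f) (heatMeasure P X q x) := by
  have h : heatMeasure P X (q + s) x = (hX.kernel s ∘ₖ hX.kernel q) x := by
    rw [Kernel.comp_apply, hX.heatMeasure_add, kernel_apply]
  rw [h] at hf
  refine ⟨?_, hf.integral_comp⟩
  rw [heatOperator, h, ProbabilityTheory.Kernel.integral_comp hf]
  rfl

omit [ProperSpace M] [BorelSpace M] in
/-- If `f ≤ e^{sL} f` for small `s`, then `f ≤ e^{tL} f` for all `t < T`. -/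
lemma le_heatOperator_of_small (hX : IsDiffusion L F X P) {f : M → ℝ} (hf : Measurable f)
    {t₁ T : ℝ≥0} (ht₁ : 0 < t₁) (hint : ∀ t < T, ∀ x, Integrable f (heatMeasure P X t x))
    (hsmall : ∀ s < t₁, s < T → ∀ x, f x ≤ heatOperator P X s f x) {t : ℝ≥0} (ht : t < T) (x : M) :
    f x ≤ heatOperator P X t f x := by
  have key : ∀ s < t₁, ∀ n : ℕ, n * s < T → f x ≤ heatOperator P X (n * s) f x := by
    intro s hs n
    induction n with
    | zero => intro _; simp [hX.heatOperator_zero hf]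
    | succ n ih =>
      intro hn
      have he : ((n + 1 : ℕ) : ℝ≥0) * s = n * s + s := by push_cast; ring
      rw [he] at hn ⊢
      have hn' : n * s < T := le_self_add.trans_lt hn
      obtain ⟨h1, h2⟩ := hX.heatOperator_add x (hint _ hn x)
      rw [h1]
      refine (ih hn').trans (integral_mono (hint _ hn' x) h2 fun y => ?_)
      exact hsmall s hs (le_add_self.trans_lt hn) y
  -- Cut [0,t] into n equal steps, each shorter than t₁.
  obtain ⟨n, hn⟩ := exists_nat_gt (t / t₁)
  have hn0 : (0 : ℝ≥0) < n := zero_le.trans_lt hn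
  have he : (n : ℝ≥0) * (t / n) = t := mul_div_cancel₀ _ hn0.ne'
  have := key (t / n) (by
    rw [div_lt_iff₀ ht₁] at hn
    rwa [div_lt_iff₀ hn0, mul_comm]) n
  rw [he] at this
  exact this ht

omit [ProperSpace M] [BorelSpace M] in
/-- If `|f| ≤ e^{tL} |f|` up to time `T`, then the `p`-th moments of `f` are nondecreasing in
time. -/
lemma lintegral_rpow_le (hX : IsDiffusion L F X P) {f : M → ℝ} (hf : Measurable f) {T : ℝ≥0}
    (h : ∀ t < T, ∀ x, |f x| ≤ ∫ y, |f y| ∂(heatMeasure P X t x)) {p : ℝ} (hp : 1 ≤ p)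
    (o : M) {s t : ℝ≥0} (hst : s ≤ t) (htT : t - s < T) :
    ∫⁻ y, ENNReal.ofReal (|f y| ^ p) ∂(heatMeasure P X s o) ≤
      ∫⁻ y, ENNReal.ofReal (|f y| ^ p) ∂(heatMeasure P X t o) := by
  have hp0 : 0 ≤ p := zero_le_one.trans hp
  have hm : Measurable fun y => ENNReal.ofReal (|f y| ^ p) :=
    (((continuous_abs.measurable.comp hf).pow_const p)).ennreal_ofReal
  have hts : t = s + (t - s) := (add_tsub_cancel_of_le hst).symm
  conv_rhs => rw [hts, hX.heatMeasure_add, Measure.lintegral_bind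
    (hX.kernel (t - s)).aemeasurable hm.aemeasurable]
  refine lintegral_mono fun x => ?_
  rw [kernel_apply]
  have := hX.isProbabilityMeasure_heatMeasure (t - s) x
  have hpow : ∀ y, ENNReal.ofReal (|f y| ^ p) = ‖f y‖ₑ ^ p := fun y => by
    rw [← ENNReal.ofReal_rpow_of_nonneg (abs_nonneg _) hp0, Real.enorm_eq_ofReal_abs]
  simp only [hpow]
  have h1 : ‖f x‖ₑ ≤ ∫⁻ y, ‖f y‖ₑ ∂(heatMeasure P X (t - s) x) := by
    have h2 := ENNReal.ofReal_le_ofReal (h _ htT x)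
    rw [← Real.enorm_eq_ofReal_abs] at h2
    refine h2.trans ?_
    rw [← Real.enorm_of_nonneg (integral_nonneg fun _ => abs_nonneg _)]
    refine (enorm_integral_le_lintegral_enorm _).trans ?_
    simp
  -- Jensen's inequality, in the form ‖f‖₁ ≤ ‖f‖_p on a probability space.
  have h3 := eLpNorm_le_eLpNorm_of_exponent_le (ENNReal.one_le_ofReal.2 hp)
    (hf.aestronglyMeasurable (μ := heatMeasure P X (t - s) x))
  rw [eLpNorm_one_eq_lintegral_enorm, eLpNorm_eq_lintegral_rpow_enorm_toReal
    (by simpa using zero_lt_one.trans_le hp) ENNReal.ofReal_ne_top, ENNReal.toReal_ofReal hp0,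
    one_div, ENNReal.le_rpow_inv_iff (zero_lt_one.trans_le hp)] at h3
  exact (ENNReal.rpow_le_rpow h1 hp0).trans h3

end IsDiffusion

/-! ### Integrability from (A) and the main theorem -/

lemma integrable_of_lintegral_rpow_lt_top {α : Type*} [MeasurableSpace α] {μ : Measure α}
    [IsFiniteMeasure μ] {f : α → ℝ} (hf : AEStronglyMeasurable f μ) {q : ℝ} (hq : 1 ≤ q)
    (h : ∫⁻ y, ENNReal.ofReal (|f y| ^ q) ∂μ < ∞) : Integrable f μ := by
  have hq0 : 0 ≤ q := zero_le_one.trans hq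
  have hpow : ∀ y, ENNReal.ofReal (|f y| ^ q) = ‖f y‖ₑ ^ q := fun y => by
    rw [← ENNReal.ofReal_rpow_of_nonneg (abs_nonneg _) hq0, Real.enorm_eq_ofReal_abs]
  simp only [hpow] at h
  have hLp : MemLp f (ENNReal.ofReal q) μ := by
    refine ⟨hf, ?_⟩
    rw [eLpNorm_lt_top_iff_lintegral_rpow_enorm_lt_top
      (by simpa using zero_lt_one.trans_le hq) ENNReal.ofReal_ne_top, ENNReal.toReal_ofReal hq0]
    exact h
  exact hLp.integrable (ENNReal.one_le_ofReal.2 hq)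

theorem theorem3p2 {d : ℕ} {M : Type*} [MetricSpace M] [ProperSpace M]
    [ChartedSpace (EuclideanSpace ℝ (Fin d)) M] [IsManifold (𝓡 d) ((⊤ : ℕ∞) : WithTop ℕ∞) M]
    [MeasurableSpace M] [BorelSpace M] {Ω : Type*} [mΩ : MeasurableSpace Ω]
    (L : C^2⟮𝓡 d, M; ℝ⟯ →ₗ[ℝ] (M → ℝ)) (F : Filtration ℝ≥0 mΩ)
    (X : ℝ≥0 → Ω → M) (P : M → Measure Ω) (hX : IsDiffusion L F X P)
    (δ : ℝ) (hδ : 0 < δ) (hloc : UniformlyLocal P X δ)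
    (f : C^2⟮𝓡 d, M; ℝ⟯) (t₀ T : ℝ≥0) (ht₀ : 0 < t₀) (hT : 0 < T)
    (hAB : ∀ x : M, ∃ η : ℝ, 0 < η ∧
      (∀ t < T, ∫⁻ y, ENNReal.ofReal (|f y| ^ (1 + η)) ∂(heatMeasure P X t x) < ∞) ∧
      (∀ t < t₀, Tendsto
        (fun n : ℕ => sSup ((fun y => |f y|) '' Metric.closedBall x n) *
          (P x).real {ω | n - δ ≤ dist (X t ω) x ∧ dist (X t ω) x ≤ n + δ} ^ (1 / (1 + η)))
        atTop (𝓝 0))) :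
    ((∀ x, L f x = 0) → ∀ t < T, ∀ x,
      Integrable f (heatMeasure P X t x) ∧ heatOperator P X t f x = f x) ∧
    ((∀ x, 0 ≤ L f x) → ∀ t < T, ∀ x,
      Integrable f (heatMeasure P X t x) ∧ f x ≤ heatOperator P X t f x) ∧
    (((∀ x, L f x = 0) ∨ ((∀ x, 0 ≤ L f x) ∧ ∀ x, 0 ≤ f x)) →
      ∀ (p : ℝ) (o : M), 1 ≤ p →
        ∫⁻ y, ENNReal.ofReal (|f y| ^ p) ∂(heatMeasure P X T o) < ∞ →
        ∀ s t : ℝ≥0, s ≤ t → t < T →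
          ∫⁻ y, ENNReal.ofReal (|f y| ^ p) ∂(heatMeasure P X s o) ≤
              ∫⁻ y, ENNReal.ofReal (|f y| ^ p) ∂(heatMeasure P X t o) ∧
            ∫⁻ y, ENNReal.ofReal (|f y| ^ p) ∂(heatMeasure P X t o) ≤
              ∫⁻ y, ENNReal.ofReal (|f y| ^ p) ∂(heatMeasure P X T o)) := by
  have hfc : Continuous f := f.contMDiff.continuous
  have hint : ∀ t < T, ∀ x, Integrable f (heatMeasure P X t x) := fun t ht x => by
    obtain ⟨η, hη, hA, -⟩ := hAB x
    have := hX.isProbabilityMeasure_heatMeasure t x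
    exact integrable_of_lintegral_rpow_lt_top hfc.measurable.aestronglyMeasurable
      (by linarith) (hA t ht)
  obtain ⟨t₁, ht₁, ε, hε, hlocal⟩ := hloc
  -- Stated for g so as to cover both f and -f: condition (B) depends only on |g|.
  have hsub : ∀ g : C^2⟮𝓡 d, M; ℝ⟯, (∀ x, |g x| = |f x|) →
      (∀ t < T, ∀ x, Integrable g (heatMeasure P X t x)) → (∀ x, 0 ≤ L g x) →
      ∀ t < T, ∀ x, g x ≤ heatOperator P X t g x := by
    intro g habs hgint hLg t ht x
    refine hX.le_heatOperator_of_small g.contMDiff.continuous.measurable (lt_min ht₀ ht₁) hgint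
      (fun s hs hsT y => ?_) ht x
    obtain ⟨η, hη, -, hB⟩ := hAB y
    refine hX.le_heatOperator_of_local g hLg y (δ := δ) (θ := 1 / (1 + η)) hε ?_
      (fun z u hu => hlocal z u (hu.trans_lt (hs.trans_le (min_le_right _ _)))) (hgint s hsT y) ?_
    · rw [div_le_one (by linarith)]
      linarith
    · simpa only [habs] using hB s (hs.trans_le (min_le_left _ _))
  have hharm : (∀ x, L f x = 0) → ∀ t < T, ∀ x, heatOperator P X t f x = f x := by
    intro hL t ht x
    refine le_antisymm ?_ (hsub f (fun _ => rfl) hint (fun y => (hL y).ge) t ht x)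
    have h := hsub (-f) (fun y => by simp) (fun t ht x => by simpa using (hint t ht x).neg)
      (fun y => by simp [hL y]) t ht x
    simp only [heatOperator, ContMDiffMap.coe_neg, Pi.neg_apply, integral_neg] at h
    exact neg_le_neg_iff.1 h
  refine ⟨fun hL t ht x => ⟨hint t ht x, hharm hL t ht x⟩,
    fun hL t ht x => ⟨hint t ht x, hsub f (fun _ => rfl) hint hL t ht x⟩, ?_⟩
  intro hcase p o hp _ s t hst htT
  have habs : ∀ t < T, ∀ x, |f x| ≤ ∫ y, |f y| ∂(heatMeasure P X t x) := by
    intro t ht x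
    rcases hcase with hL | ⟨hL, hpos⟩
    · rw [← hharm hL t ht x]
      exact abs_integral_le_integral_abs
    · simp only [abs_of_nonneg (hpos _)]
      exact hsub f (fun _ => rfl) hint hL t ht x
  have hmono : ∀ {a b : ℝ≥0}, a ≤ b → b - a < T →
      ∫⁻ y, ENNReal.ofReal (|f y| ^ p) ∂(heatMeasure P X a o) ≤
        ∫⁻ y, ENNReal.ofReal (|f y| ^ p) ∂(heatMeasure P X b o) := fun hab hba =>
    hX.lintegral_rpow_le hfc.measurable habs hp o hab hba
  refine ⟨hmono hst (tsub_le_self.trans_lt htT), ?_⟩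
  -- For t = 0 the gap T - t equals T, where `habs` is not available; two steps of length T/2
  -- replace it.
  rcases eq_zero_or_pos t with rfl | h0
  · have hhalf : T / 2 < T := NNReal.half_lt_self hT.ne'
    refine (hmono (zero_le (a := T / 2)) (by simpa using hhalf)).trans (hmono hhalf.le ?_)
    exact tsub_lt_self hT (half_pos hT)
  · exact hmono htT.le (tsub_lt_self hT h0)
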